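/- Let $\mathcal G$ be an acyclic directed graph with $p$ observed nodes and $m$ latent nodes $L_1,\dots,L_m$, in which the latent nodes have no parents and each has at least two children, all of them observed. Consider the linear structural equation model $$X_i=\sum_{u:\,u\to i}\lambda_{iu}X_u+\sum_{j:\,L_j\to i}\gamma_{ij}L_j+\epsilon_i\qquad(i=1,\dots,p),$$ where the components of $\eta=(\epsilon,L)$ are mutually independent, non-Gaussian, centered and have finite moments up to order $K$, and where, for each $j$, $\gamma_{ij}=1$ for one chosen oldest child $i$ of $L_j$ (a child none of whose ancestors is a child of $L_j$). Let $c^{(k)}_{i_1\cdots i_k}$ be the entries of the $k$th-order cumulant tensor of $X$. For observed nodes $v\ne w$ and $\ell\ge 0$ put $k_1=\ell+2$, and let $k_2>k_1$ be the smallest integer with $\ell+2\le 1+2+\cdots+(k_2-k_1+1)$. Let $A^{(\ell)}_{v\to w}$ be the matrix with columns indexed by $b\in\{0,\dots,k_1-1\}$, rows indexed by the pairs $(t,a)$ with $0\le a\le t\le k_2-k_1$, and entries $$c^{(k_1+t)}_{v\cdots v\,w\cdots w}\qquad\text{with } a+b \text{ indices equal to } w \text{ and } k_1+t-a-b \text{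 indices equal to } v$$ (that is, the $k_1$th symmetric flattenings of the cumulant tensors of $(X_v,X_w)$ of orders $k_1,\dots,k_2$ are stacked and the last column is removed). Assume that $K$ is at least the order $k_2$ belonging to each $\ell<p+m$. Below, $\ell$ ranges over those integers $\ell\ge0$ for which $k_2\le K$. Then, for Lebesgue-almost every choice of the coefficients $\lambda_{iu}$ ($u\to i$), of the coefficients $\gamma_{ij}$ ($L_j\to i$) that are not normalized to one, and of the cumulants of orders $2,\dots,K$ of the components of $\eta$, the following holds for every such model with these coefficients and cumulants. For all observed nodes $v\neq w$ there is an $\ell$ with $\operatorname{rank}A^{(\ell)}_{v\to w}=\ell+1$; and an observed node $s$ is a source (that is, it has no observed parents) if and only if, for every other observed node $w$, $$\min\{\ell:\operatorname{rank}A^{(\ell)}_{s\to w}=\ell+1\}\le\min\{\ell:\operatorname{rank}A^{(\ell)}_{w\to s}=\ell+1\}.$$ -/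

import Mathlib

open MeasureTheory ProbabilityTheory

noncomputable section

namespace LatentSEM

/-- The graph of a linear structural equation model: observed nodes `V`, latent nodes `H`, edges
`u → v` between observed nodes (`obs u v`) and edges `L_j → v` from latent to observed nodes
(`lat j v`).  The graph is acyclic, the latent nodes have no parents, and each of them has at least
two children. -/
structure LatentDAG (V H : Type*) where
  obs : V → V → Prop
  lat : H → V → Prop
  acyclic : ∀ v, ¬ Relation.TransGen obs v v
  two_children : ∀ j, ∃ a b, a ≠ b ∧ lat j a ∧ lat j b

namespace LatentDAG

variable {V H : Type*} (G : LatentDAG V H)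

/-- A source is an observed node without observed parents (it may have latent parents). -/
def IsSource (s : V) : Prop := ∀ u, ¬ G.obs u s

/-- `old` picks an oldest child of each latent node: a child none of whose ancestors is a child of
the same latent node. -/
def IsOldestChild (old : H → V) : Prop :=
  ∀ j, G.lat j (old j) ∧ ∀ c, G.lat j c → ¬ Relation.TransGen G.obs c (old j)

/-- The edges `e.1 → e.2` between observed nodes. -/
abbrev ObsEdge : Type _ := {e : V × V // G.obs e.1 e.2}

/-- The edges `L_{e.1} → e.2` from latent to observed nodes whose weight is not normalized. -/
abbrev FreeLatEdge (old : H → V) : Type _ := {e : H × V // G.lat e.1 e.2 ∧ e.2 ≠ old e.1}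

instance [Fintype V] : Fintype G.ObsEdge := Fintype.ofFinite _

instance [Fintype V] [Fintype H] (old : H → V) : Fintype (G.FreeLatEdge old) := Fintype.ofFinite _

/-- The parameter space: one real number for each edge between observed nodes, one for each edge
from a latent node to a child other than its chosen oldest child, and the cumulants of orders
`2, …, K` of all exogenous sources `η = (ε, L)`. -/
abbrev Params (old : H → V) (K : ℕ) : Type _ :=
  (G.ObsEdge → ℝ) × (G.FreeLatEdge old → ℝ) × (V ⊕ H → Finset.Icc 2 K → ℝ)

variable {G} {old : H → V} {K : ℕ}

open scoped Classical in
/-- The coefficient `λ_{iu}` of the edge `u → i`, zero if there is no such edge. -/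
def Params.lam (q : G.Params old K) (i u : V) : ℝ :=
  if h : G.obs u i then q.1 ⟨(u, i), h⟩ else 0

open scoped Classical in
/-- The coefficient `γ_{ij}` of the edge `L_j → i`: zero if there is no such edge, and one if `i` is
the chosen oldest child of `L_j`. -/
def Params.gam (q : G.Params old K) (i : V) (j : H) : ℝ :=
  if h : G.lat j i then
    if h' : i = old j then 1 else q.2.1 ⟨(j, i), h, h'⟩
  else 0

/-- The cumulant of order `k` of the exogenous source `η_j`. -/
def Params.cum (q : G.Params old K) (j : V ⊕ H) (k : Finset.Icc 2 K) : ℝ := q.2.2 j k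

end LatentDAG

/-- The entry with index `(i_1, …, i_k)` of the `k`-th order cumulant tensor of the random vector
`Z`, by the sum over all partitions of the positions `1, …, k`. -/
def cumulantTensor {ι Ω : Type*} [MeasurableSpace Ω] (P : Measure Ω) (Z : ι → Ω → ℝ)
    (k : ℕ) (i : Fin k → ι) : ℝ :=
  ∑ π : Finpartition (Finset.univ : Finset (Fin k)),
    (-1 : ℝ) ^ (π.parts.card - 1) * ((π.parts.card - 1).factorial : ℝ) *
      ∏ I ∈ π.parts, ∫ x, (∏ j ∈ I, Z (i j) x) ∂P

/-- The random vectors `ε`, `L`, `X` satisfy the linear structural equation model of the graph `G`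
with parameters `q`: the exogenous sources `η = (ε, L)` are independent, non-Gaussian and centered,
have finite moments up to order `K` and the cumulants listed in `q`, and
`X_i = ∑_u λ_{iu} X_u + ∑_j γ_{ij} L_j + ε_i`. -/
structure IsLinearSEM {V H Ω : Type*} [Fintype V] [Fintype H] [MeasurableSpace Ω]
    {G : LatentDAG V H} {old : H → V} {K : ℕ} (q : G.Params old K) (P : Measure Ω)
    (ε : V → Ω → ℝ) (L : H → Ω → ℝ) (X : V → Ω → ℝ) : Prop where
  isProbabilityMeasure : IsProbabilityMeasure P
  measurable : ∀ j, Measurable (Sum.elim ε L j)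
  indep : iIndepFun (Sum.elim ε L) P
  nonGaussian : ∀ j μ v, P.map (Sum.elim ε L j) ≠ gaussianReal μ v
  moments : ∀ j, MemLp (Sum.elim ε L j) (K : ENNReal) P
  centered : ∀ j, ∫ x, Sum.elim ε L j x ∂P = 0
  cumulants : ∀ j (k : Finset.Icc 2 K),
    cumulantTensor P (Sum.elim ε L) (k : ℕ) (fun _ => j) = q.cum j k
  equations : ∀ i, ∀ᵐ x ∂P,
    X i x = ∑ u, q.lam i u * X u x + ∑ j, q.gam i j * L j x + ε i x

/-- The nondecreasing multi-index `(v, …, v, w, …, w)` of length `n` with `b` entries `w`, where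
`v` is ordered before `w`. -/
def pairIndex {V : Type*} (v w : V) (n b : ℕ) : Fin n → V := fun r => if (r : ℕ) + b < n then v else w

/-- The matrix `A^{(k₁, …, k₁ + x)}_{v → w}`: the symmetric flattenings `fl_{k₁}` of the cumulant
tensors of `(X_v, X_w)` of orders `k₁, …, k₁ + x` are stacked vertically, and the last column is
removed.  The row `⟨t, a⟩` belongs to order `k₁ + t` and to the row index with `a` entries `w`; the
column `b` belongs to the column index with `b` entries `w`.  As `b < k₁`, the last column `b = k₁`
does not occur. -/
def flatMatrix {V Ω : Type*} [MeasurableSpace Ω] (P : Measure Ω) (X : V → Ω → ℝ) (k₁ x : ℕ)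
    (v w : V) : Matrix (Σ t : Fin (x + 1), Fin ((t : ℕ) + 1)) (Fin k₁) ℝ :=
  fun r b => cumulantTensor P X (k₁ + (r.1 : ℕ))
    (Fin.append (pairIndex v w k₁ b) (pairIndex v w (r.1 : ℕ) r.2))

theorem exists_enough_rows (l : ℕ) : ∃ x : ℕ, l + 2 ≤ ∑ t ∈ Finset.range (x + 1), (t + 1) :=
  ⟨l + 1, by rw [Finset.sum_range_succ]; omega⟩

/-- The smallest lowest order `k₁` for which `A^{(k₁, …, k₂)}` has more than `l + 1` columns. -/
def lowOrder (l : ℕ) : ℕ := l + 2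

/-- The smallest difference `k₂ - k₁` for which `A^{(k₁, …, k₂)}` has more than `l + 1` rows, the
number of rows being `1 + 2 + ⋯ + (k₂ - k₁ + 1)`. -/
def orderGap (l : ℕ) : ℕ := Nat.find (exists_enough_rows l)

/-- The highest cumulant order `k₂` that occurs in `A^{(l)}`. -/
def highOrder (l : ℕ) : ℕ := lowOrder l + orderGap l

/-- The matrix `A^{(l)}_{v → w}`. -/
def cumMatrix {V Ω : Type*} [MeasurableSpace Ω] (P : Measure Ω) (X : V → Ω → ℝ) (l : ℕ) (v w : V) :
    Matrix (Σ t : Fin (orderGap l + 1), Fin ((t : ℕ) + 1)) (Fin (lowOrder l)) ℝ :=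
  flatMatrix P X (lowOrder l) (orderGap l) v w

/-- All `l` with `rank A^{(l)}_{v → w} = l + 1`, where only those `l` are considered for which
`A^{(l)}_{v → w}` is formed from cumulants of order at most `K`. -/
def rankSet {V Ω : Type*} [MeasurableSpace Ω] (P : Measure Ω) (X : V → Ω → ℝ) (K : ℕ) (v w : V) :
    Set ℕ :=
  {l | highOrder l ≤ K ∧ (cumMatrix P X l v w).rank = l + 1}

end LatentSEM

end

/-! Solving the structural equations along the acyclic graph writes each `X_v` as `∑_j b_v(j) η_j`,
where `b_v(j)` is the total effect of source `j` on `v` (`IsLinearSEM.ae_eq_sum_effect`). Cumulants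
are multilinear and mixed cumulants of independent variables vanish, so every entry of the matrix
for `v → w` is `∑_j b_v(j)^(n-c) b_w(j)^c κ_n(j)` with `c < n` (`cumulantTensor_linear`).

Let `R(v,w)` be the set of ratios `b_w(j) / b_v(j)` over sources with `b_v(j) ≠ 0`. Grouping sources
by ratio bounds the rank by `|R(v,w)|`. Generically the rank is also at least `min(|R(v,w)|, l +
2)`: a suitable minor is nonzero for one choice of cumulants, hence for almost all
(`Params.ae_le_rank`). So the rank is `l + 1` exactly for `l = |R(v,w)| - 1`, and this `l` is below
`p + m`.

It remains to compare `|R(s,w)|` with `|R(w,s)|`. Inversion matches the nonzero ratios, so only the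
presence of `0` matters. If `s` is a source, no other `w` is an ancestor of it, and the noise of `w`
puts `0` into `R(w,s)`; hence `|R(s,w)| ≤ |R(w,s)|`. If `w` is a parent of `s`, then generically
everything affecting `w` affects `s`, so `0 ∉ R(w,s)`, while the noise of `s` puts `0` into
`R(s,w)`: the inequality fails.

Both genericity claims use lines in parameter space: along a fixed direction the bad parameters are
countable (`Params.ae_of_countable_line`). -/

namespace LatentSEM

/-! ### Set partitions and the moment–cumulant recursion -/

section Combinatorics

variable {α : Type*} [DecidableEq α]

/-- The coefficient of a partition with `r` blocks in the moment expansion of a cumulant. -/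
def moebiusCoeff (r : ℕ) : ℝ := (-1 : ℝ) ^ (r - 1) * ((r - 1).factorial : ℝ)

/-- This is the cancellation behind the moment–cumulant recursion: of `r` blocks, exactly `r - 1`
avoid a given point. -/
theorem moebiusCoeff_add {r : ℕ} (hr : 2 ≤ r) :
    moebiusCoeff r + ((r - 1 : ℕ) : ℝ) * moebiusCoeff (r - 1) = 0 := by
  obtain ⟨n, rfl⟩ := Nat.exists_eq_add_of_le hr
  have h1 : 2 + n - 1 = n + 1 := by omega
  simp only [moebiusCoeff, h1, Nat.add_sub_cancel, Nat.factorial_succ]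
  push_cast
  ring

/-- The cumulant of a finite set of positions, for an arbitrary moment functional `m`. -/
def partCumulant (m : Finset α → ℝ) (T : Finset α) : ℝ :=
  ∑ π : Finpartition T, moebiusCoeff π.parts.card * ∏ I ∈ π.parts, m I

theorem sigma_finpartition_ext {x y : Σ T : Finset α, Finpartition T}
    (h : x.2.parts = y.2.parts) : x = y := by
  obtain ⟨T, π⟩ := x
  obtain ⟨T', π'⟩ := y
  have hT : T = T' := by rw [← π.sup_parts, ← π'.sup_parts]; simp only at h; rw [h]
  subst hT
  congr 1
  exact Finpartition.ext h

/-- Removing a block from a partition. -/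
def eraseBlock {S : Finset α} (σ : Finpartition S) (I : Finset α) (hI : I ∈ σ.parts) :
    Finpartition (S \ I) where
  parts := σ.parts.erase I
  supIndep := σ.supIndep.subset (Finset.erase_subset _ _)
  sup_parts := by
    ext x
    simp only [Finset.mem_sup, Finset.mem_erase, id, Finset.mem_sdiff]
    constructor
    · rintro ⟨J, ⟨hJI, hJ⟩, hx⟩
      exact ⟨σ.le hJ hx, fun hxI => hJI (σ.eq_of_mem_parts hJ hI hx hxI)⟩
    · rintro ⟨hxS, hxI⟩
      obtain ⟨J, hJ, hx⟩ := σ.exists_mem hxS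
      exact ⟨J, ⟨fun h => hxI (h ▸ hx), hJ⟩, hx⟩
  bot_notMem := fun h => σ.bot_notMem (Finset.mem_of_mem_erase h)

/-- A partition of `T` together with the complement `S \ T` is the same as a partition of `S` with a
marked block avoiding `s`; the factor `m (S \ T)` becomes the factor of the marked block. -/
theorem sum_erase_block (m : Finset α → ℝ) {S : Finset α} {s : α} (hs : s ∈ S) :
    ∑ T ∈ S.powerset with s ∈ T ∧ T ≠ S, partCumulant m T * m (S \ T) =
      ∑ σ : Finpartition S, ∑ I ∈ σ.parts with s ∉ I,
        moebiusCoeff (σ.parts.card - 1) * ∏ J ∈ σ.parts, m J := by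
  simp only [partCumulant, Finset.sum_mul]
  rw [Finset.sum_sigma', Finset.sum_sigma']
  symm
  refine Finset.sum_bij'
    (i := fun (x : Σ _ : Finpartition S, Finset α) hx =>
      ⟨S \ x.2, eraseBlock x.1 x.2 (by simp at hx; exact hx.1)⟩)
    (j := fun (y : Σ T : Finset α, Finpartition T) hy =>
      ⟨y.2.extend (b := S \ y.1) (c := S) (by
        simp only [Finset.mem_sigma, Finset.mem_filter, Finset.mem_powerset, Finset.mem_univ,
          and_true] at hy
        intro h
        exact hy.2.2 (Finset.Subset.antisymm hy.1 (Finset.sdiff_eq_empty_iff_subset.1 h)))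
        Finset.disjoint_sdiff (by
        simp only [Finset.mem_sigma, Finset.mem_filter, Finset.mem_powerset, Finset.mem_univ,
          and_true] at hy
        exact Finset.union_sdiff_of_subset hy.1), S \ y.1⟩) ?_ ?_ ?_ ?_ ?_
  · rintro ⟨σ, I⟩ hx
    simp only [Finset.mem_sigma, Finset.mem_filter, Finset.mem_univ, true_and] at hx
    simp only [Finset.mem_sigma, Finset.mem_filter, Finset.mem_powerset, Finset.mem_univ,
      and_true, Finset.mem_sdiff]
    refine ⟨Finset.sdiff_subset, ⟨hs, hx.2⟩, fun h => ?_⟩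
    obtain ⟨x, hxI⟩ := σ.nonempty_of_mem_parts hx.1
    have hxS : x ∈ S := σ.le hx.1 hxI
    rw [← h] at hxS
    exact (Finset.mem_sdiff.1 hxS).2 hxI
  · rintro ⟨T, π⟩ hy
    simp only [Finset.mem_sigma, Finset.mem_filter, Finset.mem_powerset, Finset.mem_univ,
          and_true] at hy
    simp [hy.2.1]
  · rintro ⟨σ, I⟩ hx
    simp only [Finset.mem_sigma, Finset.mem_filter, Finset.mem_univ, true_and] at hx
    have hI : S \ (S \ I) = I := by
      rw [Finset.sdiff_sdiff_eq_self]; exact σ.le hx.1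
    have h1 : ∀ a b : Finpartition S, ∀ c d : Finset α, a.parts = b.parts → c = d →
        (⟨a, c⟩ : Σ _ : Finpartition S, Finset α) = ⟨b, d⟩ := by
      intro a b c d h h'
      rw [Finpartition.ext h, h']
    refine h1 _ _ _ _ ?_ hI
    simp only [Finpartition.extend_parts, eraseBlock, hI]
    exact Finset.insert_erase hx.1
  · rintro ⟨T, π⟩ hy
    simp only [Finset.mem_sigma, Finset.mem_filter, Finset.mem_powerset, Finset.mem_univ,
          and_true] at hy
    apply sigma_finpartition_ext
    simp only [Finpartition.extend_parts, eraseBlock]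
    refine Finset.erase_insert fun h => ?_
    obtain ⟨x, hx⟩ := π.nonempty_of_mem_parts h
    exact (Finset.mem_sdiff.1 hx).2 (π.le h hx)
  · rintro ⟨σ, I⟩ hx
    simp only [Finset.mem_sigma, Finset.mem_filter, Finset.mem_univ, true_and] at hx
    have hI : S \ (S \ I) = I := by
      rw [Finset.sdiff_sdiff_eq_self]; exact σ.le hx.1
    simp only [eraseBlock, hI, Finset.card_erase_of_mem hx.1, mul_assoc]
    rw [Finset.prod_erase_mul _ _ hx.1]

theorem card_blocks_notMem {S : Finset α} (σ : Finpartition S) {s : α} (hs : s ∈ S) :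
    (σ.parts.filter (s ∉ ·)).card = σ.parts.card - 1 := by
  obtain ⟨I, hI, hsI⟩ := σ.exists_mem hs
  rw [← Finset.card_erase_of_mem hI]
  congr 1
  ext J
  simp only [Finset.mem_filter, Finset.mem_erase]
  constructor
  · rintro ⟨hJ, hsJ⟩
    exact ⟨fun h => hsJ (h ▸ hsI), hJ⟩
  · rintro ⟨hJI, hJ⟩
    exact ⟨hJ, fun h => hJI (σ.eq_of_mem_parts hJ hI h hsI)⟩

/-- The recursion between moments and cumulants. -/
theorem sum_partCumulant_mul (m : Finset α → ℝ) (hm : m ∅ = 1) {S : Finset α} {s : α}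
    (hs : s ∈ S) :
    ∑ T ∈ S.powerset with s ∈ T, partCumulant m T * m (S \ T) = m S := by
  have hsplit : S.powerset.filter (s ∈ ·) =
      insert S (S.powerset.filter (fun T => s ∈ T ∧ T ≠ S)) := by
    ext T
    simp only [Finset.mem_filter, Finset.mem_powerset, Finset.mem_insert]
    constructor
    · rintro ⟨h1, h2⟩
      by_cases h : T = S
      · exact Or.inl h
      · exact Or.inr ⟨h1, h2, h⟩
    · rintro (rfl | ⟨h1, h2, -⟩)
      · exact ⟨subset_rfl, hs⟩
      · exact ⟨h1, h2⟩
  rw [hsplit, Finset.sum_insert (by simp), sum_erase_block m hs, Finset.sdiff_self, hm, mul_one,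
    partCumulant, ← Finset.sum_add_distrib]
  have hne : S ≠ ⊥ := fun h => by simp [h] at hs
  -- A partition with at least two blocks cancels against the ways of removing one of its blocks
  -- without `s`, so only the one-block partition survives.
  rw [Finset.sum_eq_single (Finpartition.indiscrete hne)]
  · simp [Finpartition.indiscrete, moebiusCoeff, Finset.filter_singleton, hs]
  · intro σ _ hσ
    rw [Finset.sum_const, card_blocks_notMem σ hs, nsmul_eq_mul, ← mul_assoc, ← add_mul]
    have h2 : 2 ≤ σ.parts.card := by
      have h1 : 1 ≤ σ.parts.card := Finset.card_pos.2 (σ.parts_nonempty hne)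
      by_contra hlt
      obtain ⟨I, hI⟩ := Finset.card_eq_one.1 (show σ.parts.card = 1 by omega)
      apply hσ
      apply Finpartition.ext
      have := σ.sup_parts
      rw [hI] at this
      simp at this
      simp [Finpartition.indiscrete, hI, this]
    rw [moebiusCoeff_add h2, zero_mul]
  · simp

/-- If the moments factorize along `A` and its complement, mixed cumulants vanish. -/
theorem partCumulant_eq_zero (m : Finset α → ℝ) (hm : m ∅ = 1) (A : Finset α)
    (hA : ∀ I, m I = m (I ∩ A) * m (I \ A)) (S : Finset α) {s t : α} (hs : s ∈ S) (hsA : s ∈ A)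
    (ht : t ∈ S) (htA : t ∉ A) : partCumulant m S = 0 := by
  induction S using Finset.strongInduction generalizing t with
  | H S ih =>
  have h1 := sum_partCumulant_mul m hm hs
  have h2 := sum_partCumulant_mul m hm (Finset.mem_inter.2 ⟨hs, hsA⟩)
  have hSn : S ∉ (S ∩ A).powerset.filter (s ∈ ·) := by
    simp only [Finset.mem_filter, Finset.mem_powerset, not_and]
    intro h
    exact absurd (Finset.mem_inter.1 (h ht)).2 htA
  -- By induction a proper subset containing `s` and leaving `A` has zero cumulant, so the recursion
  -- at `S` keeps only `T = S` and `T ⊆ S ∩ A`. By the recursion at `S ∩ A` the latter terms already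
  -- add up to `m (S ∩ A) * m (S \ A) = m S`, which leaves nothing for `T = S`.
  have h3 : ∑ T ∈ S.powerset with s ∈ T, partCumulant m T * m (S \ T) =
      ∑ T ∈ insert S ((S ∩ A).powerset.filter (s ∈ ·)), partCumulant m T * m (S \ T) := by
    symm
    apply Finset.sum_subset
    · intro T hT
      simp only [Finset.mem_insert, Finset.mem_filter, Finset.mem_powerset] at hT ⊢
      rcases hT with rfl | ⟨hT, hsT⟩
      · exact ⟨subset_rfl, hs⟩
      · exact ⟨hT.trans Finset.inter_subset_left, hsT⟩
    · intro T hT hT'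
      simp only [Finset.mem_insert, Finset.mem_filter, Finset.mem_powerset, not_or, not_and] at hT hT'
      have : ¬ T ⊆ S ∩ A := fun h => hT'.2 h hT.2
      obtain ⟨u, huT, hu⟩ := Finset.not_subset.1 this
      have huA : u ∉ A := fun h => hu (Finset.mem_inter.2 ⟨hT.1 huT, h⟩)
      rw [ih T (Finset.ssubset_iff_subset_ne.2 ⟨hT.1, hT'.1⟩) hT.2 huT huA, zero_mul]
  rw [h3, Finset.sum_insert hSn, Finset.sdiff_self, hm, mul_one] at h1
  have h4 : ∑ T ∈ (S ∩ A).powerset with s ∈ T, partCumulant m T * m (S \ T) =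
      (∑ T ∈ (S ∩ A).powerset with s ∈ T, partCumulant m T * m ((S ∩ A) \ T)) * m (S \ A) := by
    rw [Finset.sum_mul]
    refine Finset.sum_congr rfl fun T hT => ?_
    simp only [Finset.mem_filter, Finset.mem_powerset] at hT
    rw [hA (S \ T), mul_assoc]
    congr 3
    · ext x; simp; tauto
    · ext x
      simp only [Finset.mem_sdiff]
      have := @hT.1 x
      simp only [Finset.mem_inter] at this
      tauto
  rw [h4, h2, ← hA S] at h1
  linarith

end Combinatorics

end LatentSEM

namespace LatentSEM

/-! ### Joint cumulants as multilinear maps, and independence -/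

section Multilinear

variable {Ω : Type*} [MeasurableSpace Ω] {P : Measure Ω}

/-- Hölder's inequality with all exponents equal to `I.card ≤ K`. -/
theorem integrable_prod_of_memLp [IsProbabilityMeasure P] {ι : Type*} {K : ℕ} {f : ι → Ω → ℝ}
    {I : Finset ι} (hI : I.card ≤ K) (hf : ∀ i ∈ I, MemLp (f i) (K : ENNReal) P) :
    Integrable (fun x => ∏ i ∈ I, f i x) P := by
  rcases I.eq_empty_or_nonempty with rfl | hne
  · simp
  have hc : (I.card : ENNReal) ≠ 0 := by
    simpa using hne.ne_empty
  have h := MemLp.prod' (s := I) (f := f) (p := fun _ => (I.card : ENNReal)) (μ := P)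
    (fun i hi => (hf i hi).mono_exponent (by exact_mod_cast hI))
  rw [Finset.sum_const, nsmul_eq_mul, ENNReal.mul_inv_cancel hc (ENNReal.natCast_ne_top _),
    inv_one] at h
  exact memLp_one_iff_integrable.1 h

/-- The functions with finite moments up to order `K`. -/
def memLpSubmodule (P : Measure Ω) (K : ℕ) : Submodule ℝ (Ω → ℝ) where
  carrier := {f | MemLp f (K : ENNReal) P}
  add_mem' hf hg := hf.add hg
  zero_mem' := MemLp.zero
  smul_mem' c _ hf := hf.const_smul c

/-- Position `r` lies in exactly one block, so the product depends on the updated entry through a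
single integral, in which it occurs linearly. -/
theorem prod_blocks_update {k K : ℕ} (Y : Fin k → memLpSubmodule P K)
    (r : Fin k) (z : memLpSubmodule P K) (π : Finpartition (Finset.univ : Finset (Fin k))) :
    ∏ I ∈ π.parts, ∫ x, ∏ j ∈ I, (Function.update Y r z j : Ω → ℝ) x ∂P =
      (∫ x, (z : Ω → ℝ) x * ∏ j ∈ (π.part r).erase r, (Y j : Ω → ℝ) x ∂P) *
        ∏ I ∈ π.parts.erase (π.part r), ∫ x, ∏ j ∈ I, (Y j : Ω → ℝ) x ∂P := by
  have hr : π.part r ∈ π.parts := π.part_mem.2 (Finset.mem_univ r)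
  have hmem : r ∈ π.part r := π.mem_part (Finset.mem_univ r)
  rw [← Finset.mul_prod_erase _ _ hr]
  congr 1
  · refine integral_congr_ae (Filter.Eventually.of_forall fun x => ?_)
    simp only
    rw [← Finset.mul_prod_erase _ _ hmem, Function.update_self]
    congr 1
    refine Finset.prod_congr rfl fun j hj => ?_
    rw [Function.update_of_ne (Finset.ne_of_mem_erase hj)]
  · refine Finset.prod_congr rfl fun I hI => ?_
    have hrI : r ∉ I := fun h =>
      (Finset.ne_of_mem_erase hI) (π.eq_of_mem_parts (Finset.mem_of_mem_erase hI) hr h hmem)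
    refine integral_congr_ae (Filter.Eventually.of_forall fun x => ?_)
    refine Finset.prod_congr rfl fun j hj => ?_
    rw [Function.update_of_ne (show j ≠ r from fun h => hrI (h ▸ hj))]

theorem integrable_mul_prod_erase [IsProbabilityMeasure P] {k K : ℕ} (hk : k ≤ K)
    (Y : Fin k → memLpSubmodule P K) {r : Fin k} (z : memLpSubmodule P K) {I : Finset (Fin k)}
    (hr : r ∈ I) :
    Integrable (fun x => (z : Ω → ℝ) x * ∏ j ∈ I.erase r, (Y j : Ω → ℝ) x) P := by
  have h := integrable_prod_of_memLp (P := P) (K := K) (I := I)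
    (f := fun j => (Function.update Y r z j : Ω → ℝ))
    ((Finset.card_le_univ I).trans (by simpa using hk)) (fun j _ => (Function.update Y r z j).2)
  refine h.congr (Filter.Eventually.of_forall fun x => ?_)
  simp only
  rw [← Finset.mul_prod_erase _ _ hr, Function.update_self]
  congr 1
  refine Finset.prod_congr rfl fun j hj => ?_
  rw [Function.update_of_ne (Finset.ne_of_mem_erase hj)]

/-- The joint cumulant of order `k ≤ K` as a multilinear map. -/
noncomputable def jointCumulant (P : Measure Ω) [IsProbabilityMeasure P] {k K : ℕ} (hk : k ≤ K) :
    MultilinearMap ℝ (fun _ : Fin k => memLpSubmodule P K) ℝ where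
  toFun Y := partCumulant (fun I => ∫ x, ∏ j ∈ I, (Y j : Ω → ℝ) x ∂P) Finset.univ
  map_update_add' := by
    intro d Y r z z'
    -- The linearity fields quantify over the `DecidableEq` instance inside `Function.update`;
    -- replacing it by the standard one lets `prod_blocks_update` apply.
    obtain rfl : d = instDecidableEqFin k := Subsingleton.elim _ _
    simp only [partCumulant, prod_blocks_update, ← Finset.sum_add_distrib]
    refine Finset.sum_congr rfl fun π _ => ?_
    have hmem : r ∈ π.part r := π.mem_part (Finset.mem_univ r)
    have : ∫ x, ((z + z' : memLpSubmodule P K) : Ω → ℝ) x *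
          ∏ j ∈ (π.part r).erase r, (Y j : Ω → ℝ) x ∂P =
        (∫ x, (z : Ω → ℝ) x * ∏ j ∈ (π.part r).erase r, (Y j : Ω → ℝ) x ∂P) +
        ∫ x, (z' : Ω → ℝ) x * ∏ j ∈ (π.part r).erase r, (Y j : Ω → ℝ) x ∂P := by
      rw [← integral_add (integrable_mul_prod_erase hk Y z hmem)
        (integrable_mul_prod_erase hk Y z' hmem)]
      simp [add_mul]
    rw [this]
    ring
  map_update_smul' := by
    intro d Y r c z
    obtain rfl : d = instDecidableEqFin k := Subsingleton.elim _ _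
    simp only [partCumulant, prod_blocks_update, smul_eq_mul, Finset.mul_sum]
    refine Finset.sum_congr rfl fun π _ => ?_
    have : ∫ x, ((c • z : memLpSubmodule P K) : Ω → ℝ) x *
          ∏ j ∈ (π.part r).erase r, (Y j : Ω → ℝ) x ∂P =
        c * ∫ x, (z : Ω → ℝ) x * ∏ j ∈ (π.part r).erase r, (Y j : Ω → ℝ) x ∂P := by
      rw [← integral_const_mul]
      simp [mul_assoc]
    rw [this]
    ring

theorem cumulantTensor_eq_partCumulant {ι : Type*} (Z : ι → Ω → ℝ) (k : ℕ) (i : Fin k → ι) :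
    cumulantTensor P Z k i =
      partCumulant (fun I => ∫ x, ∏ j ∈ I, Z (i j) x ∂P) Finset.univ := rfl

theorem cumulantTensor_congr {ι : Type*} {Z Z' : ι → Ω → ℝ} (h : ∀ i, Z i =ᵐ[P] Z' i) (k : ℕ)
    (i : Fin k → ι) : cumulantTensor P Z k i = cumulantTensor P Z' k i := by
  simp only [cumulantTensor_eq_partCumulant]
  congr 1
  funext I
  refine integral_congr_ae ?_
  have : ∀ᵐ x ∂P, ∀ j, Z (i j) x = Z' (i j) x := ae_all_iff.2 fun j => h (i j)
  filter_upwards [this] with x hx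
  exact Finset.prod_congr rfl fun j _ => hx j

/-- Mixed cumulants of independent random variables vanish. -/
theorem cumulantTensor_eq_zero_of_iIndepFun {J : Type*} [Fintype J] {η : J → Ω → ℝ}
    (hη : ∀ j, Measurable (η j)) (hind : iIndepFun η P) {k : ℕ} (f : Fin k → J) {a b : Fin k}
    (hab : f a ≠ f b) : cumulantTensor P η k f = 0 := by
  classical
  have := hind.isProbabilityMeasure
  rw [cumulantTensor_eq_partCumulant]
  -- Positions are split by whether they carry the source `f a`; its independence from all the
  -- others factorizes the moments.
  refine partCumulant_eq_zero _ (by simp) (Finset.univ.filter (f · = f a)) ?_ _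
    (Finset.mem_univ a) (by simp) (Finset.mem_univ b) (by simpa using hab.symm)
  intro I
  set A := Finset.univ.filter (f · = f a)
  have h := hind.indepFun_finset {f a} (Finset.univ.erase (f a)) (by simp) hη
  have h2 := h.comp
    -- The default value `1`, here and in `ψ`, is never taken on the positions in the product.
    (φ := fun g : (({f a} : Finset J) → ℝ) => ∏ j ∈ I ∩ A,
      if hj : f j ∈ ({f a} : Finset J) then g ⟨f j, hj⟩ else 1)
    (ψ := fun g : ((Finset.univ.erase (f a) : Finset J) → ℝ) => ∏ j ∈ I \ A,
      if hj : f j ∈ Finset.univ.erase (f a) then g ⟨f j, hj⟩ else 1)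
    (by
      refine Finset.measurable_prod _ fun j _ => ?_
      split_ifs
      · exact measurable_pi_apply _
      · exact measurable_const)
    (by
      refine Finset.measurable_prod _ fun j _ => ?_
      split_ifs
      · exact measurable_pi_apply _
      · exact measurable_const)
  have e1 : (fun x => ∏ j ∈ I ∩ A, η (f j) x) = 
      (fun g : (({f a} : Finset J) → ℝ) => ∏ j ∈ I ∩ A,
        if hj : f j ∈ ({f a} : Finset J) then g ⟨f j, hj⟩ else 1) ∘ (fun x (i : ({f a} : Finset J)) => η i x) := by
    funext x
    refine Finset.prod_congr rfl fun j hj => ?_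
    have : f j ∈ ({f a} : Finset J) := by
      simp only [A, Finset.mem_inter, Finset.mem_filter] at hj
      simp [hj.2.2]
    simp only
    rw [dif_pos this]
  have e2 : (fun x => ∏ j ∈ I \ A, η (f j) x) = (fun g : ((Finset.univ.erase (f a) : Finset J) → ℝ) => ∏ j ∈ I \ A,
      if hj : f j ∈ Finset.univ.erase (f a) then g ⟨f j, hj⟩ else 1) ∘
      (fun x (i : (Finset.univ.erase (f a) : Finset J)) => η i x) := by
    funext x
    refine Finset.prod_congr rfl fun j hj => ?_
    have : f j ∈ Finset.univ.erase (f a) := by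
      simp only [A, Finset.mem_sdiff, Finset.mem_filter, Finset.mem_univ, true_and] at hj
      simp [hj.2]
    simp only
    rw [dif_pos this]
  rw [← e1, ← e2] at h2
  have h3 := h2.integral_fun_mul_eq_mul_integral
    (Finset.measurable_prod _ fun j _ => hη (f j)).aestronglyMeasurable
    (Finset.measurable_prod _ fun j _ => hη (f j)).aestronglyMeasurable
  rw [← h3]
  simp only [Finset.prod_inter_mul_prod_sdiff]

/-- The cumulant tensor of a linear transformation of independent random variables. -/
theorem cumulantTensor_linear {J V : Type*} [Fintype J] {η : J → Ω → ℝ} {X : V → Ω → ℝ} {K k : ℕ}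
    (hη : ∀ j, Measurable (η j)) (hind : iIndepFun η P) (hmom : ∀ j, MemLp (η j) (K : ENNReal) P)
    (B : V → J → ℝ) (hX : ∀ v, ∀ᵐ x ∂P, X v x = ∑ j, B v j * η j x) (hk : k ≤ K) (hk0 : 0 < k)
    (i : Fin k → V) :
    cumulantTensor P X k i = ∑ j, (∏ r, B (i r) j) * cumulantTensor P η k (fun _ => j) := by
  classical
  have := hind.isProbabilityMeasure
  let e : J → memLpSubmodule P K := fun j => ⟨η j, hmom j⟩
  have h1 : cumulantTensor P X k i = jointCumulant P hk (fun r => ∑ j, B (i r) j • e j) := by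
    rw [cumulantTensor_congr (Z' := fun v x => ∑ j, B v j * η j x) hX]
    simp [cumulantTensor_eq_partCumulant, jointCumulant, e]
  have h2 : ∀ f : Fin k → J, jointCumulant P hk (fun r => e (f r)) = cumulantTensor P η k f :=
    fun f => rfl
  rw [h1, MultilinearMap.map_sum]
  simp only [MultilinearMap.map_smul_univ, h2, smul_eq_mul]
  -- Only constant index functions survive the multilinear expansion; `0 < k` makes distinct sources
  -- give distinct constant functions.
  let g : J → (Fin k → J) := fun j _ => j
  have hg : Function.Injective g := fun a b h => congrFun h ⟨0, hk0⟩
  rw [← Finset.sum_image (f := fun f : Fin k → J => (∏ r, B (i r) (f r)) * cumulantTensor P η k f)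
    (g := g) (s := Finset.univ) hg.injOn]
  symm
  refine Finset.sum_subset (Finset.subset_univ _) fun f _ hf => ?_
  have : ∃ b, f ⟨0, hk0⟩ ≠ f b := by
    by_contra hcon
    push Not at hcon
    exact hf (Finset.mem_image.2 ⟨f ⟨0, hk0⟩, Finset.mem_univ _, funext fun b => hcon b⟩)
  obtain ⟨b, hb⟩ := this
  rw [cumulantTensor_eq_zero_of_iIndepFun hη hind f hb, mul_zero]

end Multilinear

end LatentSEM

namespace LatentSEM

/-! ### Total effects, and how they vary with one edge coefficient -/

namespace LatentDAG

variable {V H : Type*} {G : LatentDAG V H} {old : H → V} {K : ℕ}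

theorem wellFounded_obs [Finite V] (G : LatentDAG V H) : WellFounded G.obs := by
  have : IsTrans V (Relation.TransGen G.obs) := ⟨fun _ _ _ => Relation.TransGen.trans⟩
  have : Std.Irrefl (Relation.TransGen G.obs) := ⟨G.acyclic⟩
  exact Subrelation.wf (fun h => Relation.TransGen.single h)
    (Finite.wellFounded_of_trans_of_irrefl (Relation.TransGen G.obs))

open scoped Classical in
/-- The coefficient of the exogenous source `j` in the structural equation of `v`. -/
noncomputable def Params.direct (q : G.Params old K) (j : V ⊕ H) (v : V) : ℝ :=
  Sum.elim (fun u => if u = v then 1 else 0) (fun h => q.gam v h) j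

theorem Params.lam_eq_zero (q : G.Params old K) {u v : V} (h : ¬ G.obs u v) : q.lam v u = 0 :=
  dif_neg h

theorem Params.measurable_lam (u v : V) : Measurable fun q : G.Params old K => q.lam v u := by
  unfold Params.lam
  split_ifs <;> fun_prop

theorem Params.measurable_direct (j : V ⊕ H) (v : V) :
    Measurable fun q : G.Params old K => q.direct j v := by
  rcases j with u | h
  · exact measurable_const
  · simp only [Params.direct, Sum.elim_inr]
    unfold Params.gam
    split_ifs <;> fun_prop

theorem not_reflTransGen_of_obs (G : LatentDAG V H) {u v : V} (h : G.obs u v) :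
    ¬ Relation.ReflTransGen G.obs v u :=
  fun hr => G.acyclic v (Relation.TransGen.tail' hr h)

open scoped Classical in
/-- The direction in the parameter space that changes only the coefficient of one edge. -/
noncomputable def edgeDirection (G : LatentDAG V H) (old : H → V) (K : ℕ) (e : G.ObsEdge) :
    G.Params old K := (Pi.single e 1, 0, 0)

theorem Params.direct_add_edge (q : G.Params old K) (e : G.ObsEdge) (x : ℝ) (j : V ⊕ H) (v : V) :
    Params.direct (q + x • edgeDirection G old K e) j v = q.direct j v := by
  rcases j with u | l
  · rfl
  · simp [Params.direct, Params.gam, edgeDirection]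

theorem Params.lam_add_edge (q : G.Params old K) (e : G.ObsEdge) (x : ℝ) {u v : V}
    (h : (u, v) ≠ e.1) : Params.lam (q + x • edgeDirection G old K e) v u = q.lam v u := by
  classical
  unfold Params.lam
  split_ifs with h'
  · have : (⟨(u, v), h'⟩ : G.ObsEdge) ≠ e := fun he => h (congrArg Subtype.val he)
    have h0 : (Pi.single e (1 : ℝ) : G.ObsEdge → ℝ) ⟨(u, v), h'⟩ = 0 := Pi.single_eq_of_ne this 1
    simp [edgeDirection, h0]
  · rfl

theorem Params.lam_add_edge_self (q : G.Params old K) (e : G.ObsEdge) (x : ℝ) :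
    Params.lam (q + x • edgeDirection G old K e) e.1.2 e.1.1 = q.lam e.1.2 e.1.1 + x := by
  have : G.obs e.1.1 e.1.2 := e.2
  unfold Params.lam
  rw [dif_pos this, dif_pos this]
  simp [edgeDirection]

variable [Fintype V]

open scoped Classical in
/-- The total effect of the exogenous source `j` on the observed node `v`. -/
noncomputable def Params.effect (q : G.Params old K) (j : V ⊕ H) : V → ℝ :=
  G.wellFounded_obs.fix fun v ih =>
    q.direct j v + ∑ u, if h : G.obs u v then q.lam v u * ih u h else 0

theorem Params.effect_eq (q : G.Params old K) (j : V ⊕ H) (v : V) :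
    q.effect j v = q.direct j v + ∑ u, q.lam v u * q.effect j u := by
  rw [Params.effect, WellFounded.fix_eq]
  congr 1
  refine Finset.sum_congr rfl fun u _ => ?_
  split_ifs with h
  · rfl
  · rw [q.lam_eq_zero h, zero_mul]

theorem Params.measurable_effect (j : V ⊕ H) (v : V) :
    Measurable fun q : G.Params old K => q.effect j v := by
  induction v using G.wellFounded_obs.induction with
  | _ v ih =>
    simp only [fun q : G.Params old K => q.effect_eq j v]
    refine (measurable_direct j v).add (Finset.measurable_sum _ fun u _ => ?_)
    by_cases h : G.obs u v
    · exact (measurable_lam u v).mul (ih u h)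
    · simp only [fun q : G.Params old K => q.lam_eq_zero h, zero_mul]
      exact measurable_const

theorem Params.effect_eq_zero (q : G.Params old K) {u v : V}
    (h : ¬ Relation.ReflTransGen G.obs u v) : q.effect (Sum.inl u) v = 0 := by
  induction v using G.wellFounded_obs.induction with
  | _ v ih =>
    have huv : u ≠ v := fun e => h (e ▸ Relation.ReflTransGen.refl)
    rw [q.effect_eq, Finset.sum_eq_zero]
    · simp [Params.direct, huv]
    · intro w _
      by_cases hw : G.obs w v
      · rw [ih w hw fun hr => h (hr.tail hw), mul_zero]
      · rw [q.lam_eq_zero hw, zero_mul]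

theorem Params.effect_self (q : G.Params old K) (v : V) : q.effect (Sum.inl v) v = 1 := by
  rw [q.effect_eq, Finset.sum_eq_zero]
  · simp [Params.direct]
  · intro w _
    by_cases hw : G.obs w v
    · rw [q.effect_eq_zero (G.not_reflTransGen_of_obs hw), mul_zero]
    · rw [q.lam_eq_zero hw, zero_mul]

theorem Params.effect_congr {q q' : G.Params old K} (h1 : q.1 = q'.1) (h2 : q.2.1 = q'.2.1)
    (j : V ⊕ H) (v : V) : q.effect j v = q'.effect j v := by
  induction v using G.wellFounded_obs.induction with
  | _ v ih =>
    rw [q.effect_eq, q'.effect_eq]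
    congr 1
    · rcases j with u | l
      · rfl
      · simp only [Params.direct, Params.gam, Sum.elim_inr, h2]
    · refine Finset.sum_congr rfl fun u _ => ?_
      by_cases h : G.obs u v
      · rw [ih u h]
        simp only [Params.lam, h1]
      · rw [q.lam_eq_zero h, q'.lam_eq_zero h, zero_mul, zero_mul]

/-- No directed path to `v` uses the edge `e` when `v` is not reachable from its head. -/
theorem Params.effect_add_edge (q : G.Params old K) (e : G.ObsEdge) (x : ℝ) (j : V ⊕ H) {v : V}
    (hv : ¬ Relation.ReflTransGen G.obs e.1.2 v) :
    Params.effect (q + x • edgeDirection G old K e) j v = q.effect j v := by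
  induction v using G.wellFounded_obs.induction with
  | _ v ih =>
    rw [Params.effect_eq, q.effect_eq, Params.direct_add_edge]
    congr 1
    refine Finset.sum_congr rfl fun u _ => ?_
    by_cases h : G.obs u v
    · rw [ih u h fun hr => hv (hr.tail h), Params.lam_add_edge]
      rintro he
      exact hv (by rw [← he])
    · rw [q.lam_eq_zero h, Params.lam_eq_zero _ h, zero_mul, zero_mul]

/-- By acyclicity the effects on the parents of the head of `e` do not move, so only the term of `e`
itself changes. -/
theorem Params.effect_add_edge_target (q : G.Params old K) (e : G.ObsEdge) (x : ℝ) (j : V ⊕ H) :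
    Params.effect (q + x • edgeDirection G old K e) j e.1.2 =
      q.effect j e.1.2 + x * q.effect j e.1.1 := by
  classical
  rw [Params.effect_eq, q.effect_eq, Params.direct_add_edge, add_assoc]
  congr 1
  rw [← Finset.add_sum_erase _ _ (Finset.mem_univ e.1.1),
    ← Finset.add_sum_erase _ (fun u => q.lam e.1.2 u * q.effect j u) (Finset.mem_univ e.1.1),
    Params.lam_add_edge_self, Params.effect_add_edge _ _ _ _ (G.not_reflTransGen_of_obs e.2)]
  have : ∑ u ∈ Finset.univ.erase e.1.1, Params.lam (q + x • edgeDirection G old K e) e.1.2 u *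
        Params.effect (q + x • edgeDirection G old K e) j u =
      ∑ u ∈ Finset.univ.erase e.1.1, q.lam e.1.2 u * q.effect j u := by
    refine Finset.sum_congr rfl fun u hu => ?_
    by_cases h : G.obs u e.1.2
    · rw [Params.effect_add_edge _ _ _ _ (G.not_reflTransGen_of_obs h), Params.lam_add_edge]
      intro he
      exact Finset.ne_of_mem_erase hu (congrArg Prod.fst he)
    · rw [q.lam_eq_zero h, Params.lam_eq_zero _ h, zero_mul, zero_mul]
  rw [this]
  ring

theorem isAddHaarMeasure_volume_pi_pi {ι κ : Type*} [Fintype ι] [Fintype κ] :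
    (volume : Measure (ι → κ → ℝ)).IsAddHaarMeasure :=
  Measure.pi.isAddHaarMeasure (fun _ : ι => (volume : Measure (κ → ℝ)))

theorem Params.isAddHaarMeasure_volume {V H : Type*} {G : LatentDAG V H} {old : H → V} {K : ℕ}
    [Fintype V] [Fintype H] : (volume : Measure (G.Params old K)).IsAddHaarMeasure :=
  have := isAddHaarMeasure_volume_pi_pi (ι := V ⊕ H) (κ := Finset.Icc 2 K)
  have : (volume : Measure ((G.FreeLatEdge old → ℝ) ×
    (V ⊕ H → Finset.Icc 2 K → ℝ))).IsAddHaarMeasure := Measure.prod.instIsAddHaarMeasure _ _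
  Measure.prod.instIsAddHaarMeasure _ _

variable [Fintype H]

/-- A measurable property of the parameters that fails only countably often on each line in some
direction holds almost everywhere. -/
theorem Params.ae_of_countable_line {p : G.Params old K → Prop} (hp : MeasurableSet {q | p q})
    (d : G.Params old K) (h : ∀ q, {x : ℝ | ¬ p (q + x • d)}.Countable) :
    ∀ᵐ q : G.Params old K, p q := by
  have : BorelSpace (G.Params old K) := Prod.borelSpace
  have := Params.isAddHaarMeasure_volume (G := G) (old := old) (K := K)
  refine ae_mem_of_ae_add_linearMap_mem (s := {q | p q})
    (LinearMap.toSpanSingleton ℝ (G.Params old K) d) (volume : Measure ℝ) volume hp fun q => ?_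
  exact (h q).ae_notMem volume |>.mono fun x hx => by simpa using hx

/-- Generically, every exogenous source of a node affects the children of this node. -/
theorem Params.ae_effect_ne_zero : ∀ᵐ q : G.Params old K, ∀ w s : V, G.obs w s → ∀ j,
    q.effect j w ≠ 0 → q.effect j s ≠ 0 := by
  refine ae_all_iff.2 fun w => ae_all_iff.2 fun s => ?_
  by_cases h : G.obs w s
  swap
  · exact Filter.Eventually.of_forall fun q h' => absurd h' h
  simp only [h, forall_const]
  refine ae_all_iff.2 fun j => ?_
  let e : G.ObsEdge := ⟨(w, s), h⟩
  refine ae_of_countable_line ?_ (edgeDirection G old K e) fun q => ?_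
  · have h1 : MeasurableSet {q : G.Params old K | q.effect j w = 0} :=
      measurable_effect j w (measurableSet_singleton 0)
    have h2 : MeasurableSet {q : G.Params old K | q.effect j s = 0} :=
      measurable_effect j s (measurableSet_singleton 0)
    have := h1.union h2.compl
    convert this using 1
    ext q
    simp [imp_iff_not_or]
  -- The effect on `s` is affine in the coefficient of `w → s`, with slope the effect on `w`; when
  -- that slope is nonzero there is exactly one zero.
  · refine Set.Countable.mono (s₂ := {-(q.effect j s / q.effect j w)}) ?_ (Set.countable_singleton _)
    intro x hx
    simp only [Set.mem_ofPred_eq, Classical.not_imp, not_not] at hx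
    have e1 := q.effect_add_edge e x j (G.not_reflTransGen_of_obs h)
    have e2 := q.effect_add_edge_target e x j
    simp only [e] at e1 e2
    rw [e1, e2] at hx
    obtain ⟨h1, h2⟩ := hx
    rw [Set.mem_singleton_iff]
    field_simp
    linarith

end LatentDAG

open LatentDAG

/-- In a linear structural equation model the observed variables are the linear combinations of the
exogenous sources given by the total effects. -/
theorem IsLinearSEM.ae_eq_sum_effect {V H Ω : Type*} [Fintype V] [Fintype H] [MeasurableSpace Ω]
    {G : LatentDAG V H} {old : H → V} {K : ℕ} {q : G.Params old K} {P : Measure Ω}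
    {ε : V → Ω → ℝ} {L : H → Ω → ℝ} {X : V → Ω → ℝ} (h : IsLinearSEM q P ε L X) (v : V) :
    ∀ᵐ x ∂P, X v x = ∑ j, q.effect j v * Sum.elim ε L j x := by
  classical
  filter_upwards [ae_all_iff.2 h.equations] with x hx
  induction v using G.wellFounded_obs.induction with
  | _ v ih =>
    have h1 : ∑ u, q.lam v u * X u x =
        ∑ u, q.lam v u * ∑ j, q.effect j u * Sum.elim ε L j x := by
      refine Finset.sum_congr rfl fun u _ => ?_
      by_cases hu : G.obs u v
      · rw [ih u hu]
      · rw [q.lam_eq_zero hu, zero_mul, zero_mul]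
    have h2 : ∑ j, q.direct j v * Sum.elim ε L j x = ε v x + ∑ l, q.gam v l * L l x := by
      rw [Fintype.sum_sum_type]
      simp [Params.direct]
    simp only [fun j => q.effect_eq j v, add_mul, Finset.sum_add_distrib]
    rw [h2, hx v, h1]
    simp only [Finset.mul_sum, Finset.sum_mul]
    rw [Finset.sum_comm]
    simp only [mul_assoc]
    ring

end LatentSEM

namespace LatentSEM

/-! ### Rank bounds for the stacked flattenings -/

section LinearAlgebra

/-- A block diagonal arrangement of generalized Vandermonde matrices is invertible if the exponents
in each block are an initial segment of the natural numbers. -/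
theorem det_blockVandermonde_ne_zero {ι T : Type*} [Fintype ι] [DecidableEq ι] [DecidableEq T]
    (τ : ι → T) (a : ι → ℕ) (ρ : ι → ℝ) (hρ : Function.Injective ρ)
    (hinj : ∀ i i', τ i = τ i' → a i = a i' → i = i')
    (hcard : ∀ i, a i < (Finset.univ.filter (τ · = τ i)).card) :
    (Matrix.of fun i' i => if τ i = τ i' then ρ i ^ a i' else 0 : Matrix ι ι ℝ).det ≠ 0 := by
  intro hdet
  obtain ⟨y, hy, hyM⟩ := Matrix.exists_vecMul_eq_zero_iff.2 hdet
  apply hy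
  funext i₀
  set F := Finset.univ.filter (τ · = τ i₀) with hF
  -- The entries of a left kernel vector in one block are the coefficients of a polynomial of degree
  -- below `|F|` with `|F|` distinct roots. As exponents within a block are distinct, each `y i'` is
  -- recovered as a coefficient.
  let p : Polynomial ℝ := ∑ i' ∈ F, Polynomial.monomial (a i') (y i')
  have hp : p = 0 := by
    refine Polynomial.eq_zero_of_degree_lt_of_eval_finset_eq_zero (F.image ρ) ?_ ?_
    · rw [Finset.card_image_of_injective _ hρ, ← Polynomial.mem_degreeLT]
      refine Submodule.sum_mem _ fun i hi => ?_
      rw [Polynomial.mem_degreeLT]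
      refine (Polynomial.degree_monomial_le _ _).trans_lt ?_
      have := hcard i
      rw [(Finset.mem_filter.1 hi).2, ← hF] at this
      exact_mod_cast this
    · intro z hz
      obtain ⟨i, hi, rfl⟩ := Finset.mem_image.1 hz
      have h := congrFun hyM i
      simp only [Matrix.vecMul, dotProduct, Matrix.of_apply, Pi.zero_apply, mul_ite, mul_zero,
        (Finset.mem_filter.1 hi).2] at h
      rw [← h, Polynomial.eval_finsetSum, Finset.sum_filter]
      refine Finset.sum_congr rfl fun i' _ => ?_
      simp only [eq_comm (a := τ i') (b := τ i₀), Polynomial.eval_monomial]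
  have h2 : p.coeff (a i₀) = y i₀ := by
    simp only [p, Polynomial.finsetSum_coeff, Polynomial.coeff_monomial]
    rw [Finset.sum_eq_single i₀]
    · simp
    · intro i hi hne
      exact if_neg fun h => hne (hinj i i₀ (Finset.mem_filter.1 hi).2 h)
    · intro h
      exact absurd (by simp [F]) h
  simpa [hp] using h2.symm

/-- The first `r` of the pairs `(t, a)` with `a ≤ t ≤ x` in the lexicographic order. -/
theorem exists_initial_rows {r x : ℕ} (hr : r ≤ ∑ t ∈ Finset.range (x + 1), (t + 1)) :
    ∃ e : Fin r → (Σ t : Fin (x + 1), Fin ((t : ℕ) + 1)), Function.Injective e ∧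
      ∀ i, ((e i).2 : ℕ) < (Finset.univ.filter fun i' => (e i').1 = (e i).1).card := by
  have hr' : r ≤ ∑ t : Fin (x + 1), ((t : ℕ) + 1) := by
    rwa [Fin.sum_univ_eq_sum_range (fun t => t + 1)]
  let φ := finSigmaFinEquiv (n := fun t : Fin (x + 1) => (t : ℕ) + 1)
  refine ⟨fun i => φ.symm (Fin.castLE hr' i), fun i i' h => ?_, fun i => ?_⟩
  · simpa using h
  set s := φ.symm (Fin.castLE hr' i) with hs
  have hi : (φ s : ℕ) = i := by simp [hs]
  have hlt : ∀ c : Fin ((s.2 : ℕ) + 1), (c : ℕ) < (s.1 : ℕ) + 1 := fun c => by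
    have := s.2.2; have := c.2; omega
  have hval : ∀ c : Fin ((s.2 : ℕ) + 1), (φ ⟨s.1, ⟨c, hlt c⟩⟩ : ℕ) < r := fun c => by
    have h1 := finSigmaFinEquiv_apply (n := fun t : Fin (x + 1) => (t : ℕ) + 1) ⟨s.1, ⟨c, hlt c⟩⟩
    have h2 := finSigmaFinEquiv_apply (n := fun t : Fin (x + 1) => (t : ℕ) + 1) s
    change (φ s : ℕ) = _ at h2
    change (φ _ : ℕ) = _ at h1
    rw [h1]
    have := c.2
    have := i.2
    simp only at h2 ⊢
    omega
  have hback : ∀ c : Fin ((s.2 : ℕ) + 1), φ.symm (Fin.castLE hr' ⟨φ ⟨s.1, ⟨c, hlt c⟩⟩, hval c⟩) =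
      ⟨s.1, ⟨c, hlt c⟩⟩ := fun c => by rw [Equiv.symm_apply_eq]; rfl
  -- The `s.2 + 1` pairs with first component `s.1` and second component at most `s.2` come no later
  -- than `s`, hence are all selected.
  have hle := Finset.card_le_card_of_injOn (s := (Finset.univ : Finset (Fin ((s.2 : ℕ) + 1))))
    (t := Finset.univ.filter fun i' : Fin r => (φ.symm (Fin.castLE hr' i')).1 = s.1)
    (fun c => ⟨φ ⟨s.1, ⟨c, hlt c⟩⟩, hval c⟩)
    (by
      intro c _
      simp only [Finset.coe_filter, Finset.mem_univ, true_and]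
      have h := congrArg Sigma.fst (hback c)
      exact h)
    (by
      intro c _ c' _ h
      have h3 := φ.injective (Fin.ext (Fin.mk.inj_iff.1 h))
      simpa [Fin.ext_iff] using h3)
  rw [Finset.card_univ, Fintype.card_fin] at hle
  exact hle

variable {J : Type*} [Fintype J]

/-- The stacked flattenings for two linear combinations, with coefficients `bv` and `bw`, of
independent sources with cumulants `κ`. -/
def pairMatrix (bv bw : J → ℝ) (κ : J → ℕ → ℝ) (k₁ x : ℕ) :
    Matrix (Σ t : Fin (x + 1), Fin ((t : ℕ) + 1)) (Fin k₁) ℝ :=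
  fun r b => ∑ j, bv j ^ ((k₁ + r.1) - (b + r.2)) * bw j ^ ((b : ℕ) + r.2) * κ j (k₁ + r.1)

open scoped Classical in
/-- The finite ratios of the coefficients of the sources. -/
noncomputable def ratios (bv bw : J → ℝ) : Finset ℝ :=
  (Finset.univ.filter fun j => bv j ≠ 0).image fun j => bw j / bv j

theorem pow_mul_pow_eq {x y : ℝ} (hx : x ≠ 0) {n c : ℕ} (h : c ≤ n) :
    x ^ (n - c) * y ^ c = x ^ n * (y / x) ^ c := by
  obtain ⟨d, rfl⟩ := Nat.exists_eq_add_of_le h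
  rw [Nat.add_sub_cancel_left, div_pow, pow_add]
  field_simp

theorem pairMatrix_index_le {k₁ x : ℕ} (r : Σ t : Fin (x + 1), Fin ((t : ℕ) + 1)) (b : Fin k₁) :
    (b : ℕ) + r.2 < k₁ + r.1 := by
  have := r.2.2; have := b.2; omega

/-- Sources with equal ratio contribute proportional rows, so the matrix factors through a space
with one coordinate per ratio. Sources with `bv j = 0` drop out because the exponent of `bv j` is
always positive; this is what removing the last column achieves. -/
theorem rank_pairMatrix_le (bv bw : J → ℝ) (κ : J → ℕ → ℝ) (k₁ x : ℕ) :
    (pairMatrix bv bw κ k₁ x).rank ≤ (ratios bv bw).card := by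
  classical
  let M : Matrix (Σ t : Fin (x + 1), Fin ((t : ℕ) + 1)) (ratios bv bw) ℝ := fun r z =>
    ∑ j ∈ Finset.univ.filter fun j => bv j ≠ 0 with bw j / bv j = z,
      bv j ^ (k₁ + (r.1 : ℕ)) * (z : ℝ) ^ (r.2 : ℕ) * κ j (k₁ + r.1)
  let N : Matrix (ratios bv bw) (Fin k₁) ℝ := fun z b => (z : ℝ) ^ (b : ℕ)
  have h : pairMatrix bv bw κ k₁ x = M * N := by
    ext r b
    have hlt := pairMatrix_index_le r b
    rw [pairMatrix, Matrix.mul_apply]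
    have h1 : ∑ j, bv j ^ ((k₁ + r.1) - (b + r.2)) * bw j ^ ((b : ℕ) + r.2) * κ j (k₁ + r.1) =
        ∑ j with bv j ≠ 0, bv j ^ (k₁ + (r.1 : ℕ)) * (bw j / bv j) ^ ((b : ℕ) + r.2) *
          κ j (k₁ + r.1) := by
      rw [Finset.sum_filter]
      refine Finset.sum_congr rfl fun j _ => ?_
      split_ifs with hj
      · rw [pow_mul_pow_eq hj hlt.le]
      · rw [not_not.1 hj, zero_pow (by omega), zero_mul, zero_mul]
    rw [h1, ← Finset.sum_fiberwise_of_maps_to (t := ratios bv bw) (g := fun j => bw j / bv j)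
      (fun j hj => Finset.mem_image_of_mem _ hj), ← Finset.sum_coe_sort]
    refine Finset.sum_congr rfl fun z _ => ?_
    simp only [M, N, Finset.sum_mul]
    refine Finset.sum_congr rfl fun j hj => ?_
    rw [(Finset.mem_filter.1 hj).2, pow_add]
    ring
  rw [h]
  refine (Matrix.rank_mul_le_left M N).trans ((Matrix.rank_le_card_width M).trans ?_)
  rw [Fintype.card_coe]

/-- Cumulants which put the `i`-th selected source into the block of order `k₁ + τ i`. -/
def selectedCumulants {r : ℕ} [DecidableEq J] (s : Fin r → J) (d : Fin r → ℕ) (j : J) (k : ℕ) : ℝ :=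
  ∑ i, if j = s i ∧ k = d i then 1 else 0

/-- When each selected source has a nonzero cumulant in only one of the stacked orders, the minor is
a product of a block Vandermonde matrix (rows), a diagonal matrix of powers of `bv` and an ordinary
Vandermonde matrix (columns), all invertible for distinct ratios. -/
theorem det_pairMatrix_selected_ne_zero [DecidableEq J] {bv bw : J → ℝ} {k₁ x r : ℕ}
    (hrk : r ≤ k₁) (e : Fin r → (Σ t : Fin (x + 1), Fin ((t : ℕ) + 1)))
    (he : Function.Injective e)
    (hcard : ∀ i, ((e i).2 : ℕ) < (Finset.univ.filter fun i' => (e i').1 = (e i).1).card)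
    (s : Fin r → J) (hs : ∀ i, bv (s i) ≠ 0)
    (hinj : Function.Injective fun i => bw (s i) / bv (s i)) {κ : J → ℕ → ℝ}
    (hκ : ∀ j, ∀ t : Fin (x + 1), κ j (k₁ + t) =
      selectedCumulants s (fun i => k₁ + ((e i).1 : ℕ)) j (k₁ + t)) :
    ((pairMatrix bv bw κ k₁ x).submatrix e (Fin.castLE hrk)).det ≠ 0 := by
  let ρ : Fin r → ℝ := fun i => bw (s i) / bv (s i)
  have h : (pairMatrix bv bw κ k₁ x).submatrix e (Fin.castLE hrk) =
      (Matrix.of fun i' i => if (e i).1 = (e i').1 then ρ i ^ ((e i').2 : ℕ) else 0) *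
        Matrix.diagonal (fun i => bv (s i) ^ (k₁ + ((e i).1 : ℕ))) * Matrix.vandermonde ρ := by
    ext i' b
    rw [Matrix.mul_apply]
    simp only [Matrix.submatrix_apply, pairMatrix, hκ, selectedCumulants, Finset.mul_sum]
    rw [Finset.sum_comm]
    refine Finset.sum_congr rfl fun i _ => ?_
    rw [Matrix.mul_diagonal, Matrix.vandermonde_apply, Matrix.of_apply]
    rw [Finset.sum_eq_single (s i)]
    · have hlt := pairMatrix_index_le (e i') (Fin.castLE hrk b)
      by_cases ht : (e i).1 = (e i').1
      · rw [pow_mul_pow_eq (hs i) hlt.le]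
        simp only [ht, and_self, if_true, Fin.val_castLE, pow_add, ρ]
        ring
      · have : ((e i').1 : ℕ) ≠ (e i).1 := fun h => ht (Fin.ext h.symm)
        simp [ht, this]
    · intro j _ hj
      simp [hj]
    · simp
  rw [h, Matrix.det_mul, Matrix.det_mul, Matrix.det_diagonal]
  refine mul_ne_zero (mul_ne_zero ?_ ?_) ?_
  · refine det_blockVandermonde_ne_zero _ _ _ hinj (fun i i' h1 h2 => he ?_) hcard
    have h3 : ∀ p p' : Σ t : Fin (x + 1), Fin ((t : ℕ) + 1), p.1 = p'.1 → (p.2 : ℕ) = p'.2 →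
        p = p' := by
      rintro ⟨t, a⟩ ⟨t', a'⟩ h h'
      simp only at h
      subst h
      simp only at h'
      rw [Fin.ext h']
    exact h3 _ _ h1 h2
  · exact Finset.prod_ne_zero_iff.2 fun i _ => pow_ne_zero _ (hs i)
  · exact Matrix.det_vandermonde_ne_zero_iff.2 hinj

/-- The determinant is a polynomial in `x` whose coefficient in degree `card ι` is `B.det`, so it
has finitely many roots. -/
theorem countable_det_add_smul_eq_zero {ι : Type*} [Fintype ι] [DecidableEq ι]
    (A B : Matrix ι ι ℝ) (hB : B.det ≠ 0) : {x : ℝ | (A + x • B).det = 0}.Countable := by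
  let p : Polynomial ℝ :=
    ((Polynomial.X : Polynomial ℝ) • B.map Polynomial.C + A.map Polynomial.C).det
  have hp : p ≠ 0 := fun h => hB (by
    rw [← Polynomial.coeff_det_X_add_C_card B A]
    change p.coeff _ = 0
    rw [h, Polynomial.coeff_zero])
  refine Set.Countable.mono (fun x hx => ?_) (p.roots.toFinset.countable_toSet)
  have : p.eval x = (A + x • B).det := by
    rw [← Polynomial.coe_evalRingHom, RingHom.map_det]
    congr 1
    ext i j
    simp
    ring
  simp only [Finset.mem_coe, Multiset.mem_toFinset]
  rw [Polynomial.mem_roots hp, Polynomial.IsRoot, this]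
  exact hx

theorem prod_pairIndex {V : Type*} (v w : V) (f : V → ℝ) {n b : ℕ} (hb : b ≤ n) :
    ∏ r, f (pairIndex v w n b r) = f v ^ (n - b) * f w ^ b := by
  obtain ⟨c, rfl⟩ := Nat.exists_eq_add_of_le' hb
  rw [Fin.prod_univ_add]
  simp [pairIndex]

end LinearAlgebra

end LatentSEM

namespace LatentSEM

open LatentDAG

/-! ### Generic rank equals a count of effect ratios -/

section Generic

variable {V H : Type*} {G : LatentDAG V H} {old : H → V} {K : ℕ}

/-- The cumulants of the exogenous sources, extended by zero to all orders. -/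
noncomputable def LatentDAG.Params.cumExt (q : G.Params old K) (j : V ⊕ H) (k : ℕ) : ℝ :=
  if h : k ∈ Finset.Icc 2 K then q.cum j ⟨k, h⟩ else 0

theorem LatentDAG.Params.measurable_cumExt (j : V ⊕ H) (k : ℕ) :
    Measurable fun q : G.Params old K => q.cumExt j k := by
  unfold Params.cumExt Params.cum
  split_ifs <;> fun_prop

theorem LatentDAG.Params.cumExt_add_smul (q d : G.Params old K) (x : ℝ) (j : V ⊕ H) (k : ℕ) :
    Params.cumExt (q + x • d) j k = q.cumExt j k + x * d.cumExt j k := by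
  unfold Params.cumExt
  split_ifs
  · simp [Params.cum]
  · simp

theorem LatentDAG.IsSource.not_reflTransGen {s w : V} (hs : G.IsSource s) (hne : w ≠ s) :
    ¬ Relation.ReflTransGen G.obs w s := fun h => by
  rcases Relation.ReflTransGen.cases_tail h with h | ⟨u, -, hu⟩
  · exact hne h.symm
  · exact hs u hu

variable [Fintype V] [Fintype H]

/-- The matrix `A^{(l)}_{v → w}` in terms of the parameters. -/
noncomputable def LatentDAG.Params.cumMatrix (q : G.Params old K) (l : ℕ) (v w : V) :
    Matrix (Σ t : Fin (orderGap l + 1), Fin ((t : ℕ) + 1)) (Fin (lowOrder l)) ℝ :=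
  pairMatrix (fun j => q.effect j v) (fun j => q.effect j w) q.cumExt (lowOrder l) (orderGap l)

/-- The matrix depends on the model only through the parameters, so one null set of parameters
serves all probability spaces and random vectors at once. -/
theorem IsLinearSEM.cumMatrix_eq {Ω : Type*} [MeasurableSpace Ω] {q : G.Params old K}
    {P : Measure Ω} {ε : V → Ω → ℝ} {L : H → Ω → ℝ} {X : V → Ω → ℝ} (h : IsLinearSEM q P ε L X)
    {l : ℕ} (hl : highOrder l ≤ K) (v w : V) : cumMatrix P X l v w = q.cumMatrix l v w := by
  ext r b
  have hk : lowOrder l + (r.1 : ℕ) ∈ Finset.Icc 2 K := by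
    have := r.1.2
    simp only [highOrder, lowOrder, Finset.mem_Icc] at hl ⊢
    omega
  have hk' := Finset.mem_Icc.1 hk
  have ha := r.2.2
  have hb := b.2
  simp only [cumMatrix, flatMatrix, Params.cumMatrix, pairMatrix]
  rw [cumulantTensor_linear h.measurable h.indep h.moments (fun v j => q.effect j v)
    h.ae_eq_sum_effect hk'.2 (by omega)]
  refine Finset.sum_congr rfl fun j _ => ?_
  rw [h.cumulants j ⟨_, hk⟩, Params.cumExt, dif_pos hk, Fin.prod_univ_add]
  simp only [Fin.append_left, Fin.append_right]
  rw [prod_pairIndex v w (fun v => q.effect j v) hb.le,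
    prod_pairIndex v w (fun v => q.effect j v) (Nat.lt_succ_iff.1 ha)]
  have e : lowOrder l + (r.1 : ℕ) - (b + r.2) = (lowOrder l - b) + (r.1 - r.2) := by omega
  rw [e, pow_add, pow_add]
  ring

/-- Generically, the rank of `A^{(l)}_{v → w}` is at least any number `r ≤ l + 2` of sources that
affect `v` and have distinct ratios. -/
theorem LatentDAG.Params.ae_le_rank {l r : ℕ} (hl : highOrder l ≤ K) (hr : r ≤ l + 2) (v w : V)
    (s : Fin r → V ⊕ H) : ∀ᵐ q : G.Params old K,
      ((∀ i, q.effect (s i) v ≠ 0) ∧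
        ∀ i i', i ≠ i' → q.effect (s i) w / q.effect (s i) v ≠
          q.effect (s i') w / q.effect (s i') v) →
      r ≤ (q.cumMatrix l v w).rank := by
  classical
  -- The choice of `orderGap l` guarantees at least `l + 2` rows.
  obtain ⟨e, he, hcard⟩ := exists_initial_rows (x := orderGap l)
    (hr.trans (Nat.find_spec (exists_enough_rows l)))
  let sub : G.Params old K → Matrix (Fin r) (Fin r) ℝ := fun q =>
    (q.cumMatrix l v w).submatrix e (Fin.castLE hr)
  suffices hdet : ∀ᵐ q : G.Params old K, ((∀ i, q.effect (s i) v ≠ 0) ∧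
        ∀ i i', i ≠ i' → q.effect (s i) w / q.effect (s i) v ≠
          q.effect (s i') w / q.effect (s i') v) → (sub q).det ≠ 0 by
    filter_upwards [hdet] with q hq hc
    have h1 := Matrix.rank_of_det_ne_zero (hq hc)
    rw [Fintype.card_fin] at h1
    rw [← h1]
    exact Matrix.rank_submatrix_le _ _ _
  let κ : V ⊕ H → ℕ → ℝ := selectedCumulants s (fun i => lowOrder l + ((e i).1 : ℕ))
  -- This direction moves cumulants only: the effects, and with them the condition on the ratios,
  -- stay constant along the line, while the minor's matrix is affine with slope `D` below.
  let d : G.Params old K := (0, 0, fun j k => κ j k)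
  have hdκ : ∀ j, ∀ t : Fin (orderGap l + 1), d.cumExt j (lowOrder l + t) =
      κ j (lowOrder l + t) := fun j t => by
    have hk : lowOrder l + (t : ℕ) ∈ Finset.Icc 2 K := by
      have := t.2
      simp only [highOrder, lowOrder, Finset.mem_Icc] at hl ⊢
      omega
    rw [Params.cumExt, dif_pos hk]
    rfl
  have heff : ∀ (q : G.Params old K) (x : ℝ) j u,
      Params.effect (q + x • d) j u = q.effect j u := fun q x j u =>
    Params.effect_congr (by simp [d]) (by simp [d]) j u
  refine Params.ae_of_countable_line ?_ d fun q => ?_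
  · refine MeasurableSet.imp ?_ ?_
    · refine MeasurableSet.inter (s₁ := {q : G.Params old K | ∀ i, q.effect (s i) v ≠ 0})
        (s₂ := {q : G.Params old K | ∀ i i', i ≠ i' → q.effect (s i) w / q.effect (s i) v ≠
          q.effect (s i') w / q.effect (s i') v}) ?_ ?_
      · have h : {q : G.Params old K | ∀ i, q.effect (s i) v ≠ 0} =
            ⋂ i, {q : G.Params old K | q.effect (s i) v = 0}ᶜ := by
          ext q
          simp
        rw [h]
        exact MeasurableSet.iInter fun i =>
          (Params.measurable_effect (s i) v (measurableSet_singleton 0)).compl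
      · have h : {q : G.Params old K | ∀ i i', i ≠ i' → q.effect (s i) w / q.effect (s i) v ≠
            q.effect (s i') w / q.effect (s i') v} = ⋂ i, ⋂ i', ⋂ _ : i ≠ i',
            {q : G.Params old K | q.effect (s i) w / q.effect (s i) v =
              q.effect (s i') w / q.effect (s i') v}ᶜ := by
          ext q
          simp
        rw [h]
        refine MeasurableSet.iInter fun i => MeasurableSet.iInter fun i' =>
          MeasurableSet.iInter fun _ => ?_
        exact (measurableSet_eq_fun
          ((Params.measurable_effect (s i) w).div (Params.measurable_effect (s i) v))
          ((Params.measurable_effect (s i') w).div (Params.measurable_effect (s i') v))).compl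
    · have : Measurable fun q => (sub q).det := by
        simp only [Matrix.det_apply]
        refine Finset.measurable_sum _ fun σ _ => Measurable.const_smul
          (Finset.measurable_prod _ fun i _ => ?_) _
        refine Finset.measurable_sum _ fun j _ => ?_
        exact (((Params.measurable_effect j v).pow_const _).mul
          ((Params.measurable_effect j w).pow_const _)).mul (Params.measurable_cumExt j _)
      exact (this (measurableSet_singleton 0)).compl
  · by_cases hc : (∀ i, q.effect (s i) v ≠ 0) ∧
        ∀ i i', i ≠ i' → q.effect (s i) w / q.effect (s i) v ≠
          q.effect (s i') w / q.effect (s i') v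
    swap
    · convert Set.countable_empty
      ext x
      simp only [heff]
      simp [hc]
    let D : Matrix (Fin r) (Fin r) ℝ := (pairMatrix (fun j => q.effect j v)
      (fun j => q.effect j w) d.cumExt (lowOrder l) (orderGap l)).submatrix e (Fin.castLE hr)
    have hD : D.det ≠ 0 := det_pairMatrix_selected_ne_zero hr e he hcard s hc.1
      (fun i i' h => not_imp_comm.1 (hc.2 i i') (not_not.2 h)) hdκ
    refine (countable_det_add_smul_eq_zero (sub q) D hD).mono fun x hx => ?_
    have hsub : sub (q + x • d) = sub q + x • D := by
      ext i b
      simp only [sub, D, Params.cumMatrix, pairMatrix, Matrix.submatrix_apply, Matrix.add_apply,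
        Matrix.smul_apply, smul_eq_mul, heff, Params.cumExt_add_smul, Finset.mul_sum,
        ← Finset.sum_add_distrib]
      refine Finset.sum_congr rfl fun j _ => ?_
      ring
    have hx' := (Classical.not_imp.1 hx).2
    rw [hsub, not_not] at hx'
    exact hx'

theorem exists_sources_of_le_card_ratios {J : Type*} [Fintype J] {bv bw : J → ℝ} {r : ℕ}
    (hr : r ≤ (ratios bv bw).card) : ∃ s : Fin r → J, (∀ i, bv (s i) ≠ 0) ∧
      ∀ i i', i ≠ i' → bw (s i) / bv (s i) ≠ bw (s i') / bv (s i') := by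
  let z : Fin r → ratios bv bw := fun i => (ratios bv bw).equivFin.symm (Fin.castLE hr i)
  have hz : Function.Injective z := fun i i' h => by simpa [z] using h
  have hex : ∀ i, ∃ j, bv j ≠ 0 ∧ bw j / bv j = z i := fun i => by
    have := (z i).2
    simp only [ratios, Finset.mem_image, Finset.mem_filter, Finset.mem_univ, true_and] at this
    exact this
  choose s hs hs' using hex
  refine ⟨s, hs, fun i i' hne h => hne (hz (Subtype.ext ?_))⟩
  rw [← hs', ← hs', h]

/-- The set of the ratios of the effects of the sources on `w` and on `v`. -/
noncomputable def LatentDAG.Params.effectRatios (q : G.Params old K) (v w : V) : Finset ℝ :=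
  ratios (fun j => q.effect j v) (fun j => q.effect j w)

/-- Generically, the rank of `A^{(l)}_{v → w}` is `l + 1` if and only if there are exactly `l + 1`
ratios of effects. -/
theorem LatentDAG.Params.ae_rank_eq_iff : ∀ᵐ q : G.Params old K, ∀ v w l, highOrder l ≤ K →
    ((q.cumMatrix l v w).rank = l + 1 ↔ (q.effectRatios v w).card = l + 1) := by
  have h : ∀ᵐ q : G.Params old K, ∀ (v w : V) (l r : ℕ) (s : Fin r → V ⊕ H), highOrder l ≤ K →
      r ≤ l + 2 → ((∀ i, q.effect (s i) v ≠ 0) ∧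
        ∀ i i', i ≠ i' → q.effect (s i) w / q.effect (s i) v ≠
          q.effect (s i') w / q.effect (s i') v) → r ≤ (q.cumMatrix l v w).rank := by
    simp only [ae_all_iff]
    intro v w l r s hl hr
    exact Params.ae_le_rank hl hr v w s
  filter_upwards [h] with q hq v w l hl
  have hle : (q.cumMatrix l v w).rank ≤ (q.effectRatios v w).card := rank_pairMatrix_le _ _ _ _ _
  have hge : ∀ r, r ≤ l + 2 → r ≤ (q.effectRatios v w).card → r ≤ (q.cumMatrix l v w).rank := by
    intro r hr hr'
    obtain ⟨s, hs, hs'⟩ := exists_sources_of_le_card_ratios hr'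
    exact hq v w l r s hl hr ⟨hs, hs'⟩
  constructor
  · intro h1
    by_contra hne
    -- The matrix has room for rank `l + 2`, so more than `l + 1` ratios would show; fewer are
    -- excluded by `hle`.
    have := hge (l + 2) le_rfl (by omega)
    omega
  · intro h1
    have := hge (l + 1) (by omega) (by omega)
    omega

/-! ### Comparing ratios in the two directions by inversion -/

theorem LatentDAG.Params.mem_effectRatios {q : G.Params old K} {v w : V} {z : ℝ} :
    z ∈ q.effectRatios v w ↔ ∃ j, q.effect j v ≠ 0 ∧ q.effect j w / q.effect j v = z := by
  simp [Params.effectRatios, ratios]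

theorem LatentDAG.Params.card_effectRatios_pos (q : G.Params old K) (v w : V) :
    0 < (q.effectRatios v w).card :=
  Finset.card_pos.2 ⟨_, mem_effectRatios.2 ⟨Sum.inl v, by simp [q.effect_self], rfl⟩⟩

theorem LatentDAG.Params.card_effectRatios_le (q : G.Params old K) (v w : V) :
    (q.effectRatios v w).card ≤ Fintype.card V + Fintype.card H := by
  classical
  refine Finset.card_image_le.trans ((Finset.card_le_univ _).trans ?_)
  simp

theorem LatentDAG.Params.inv_mem_effectRatios {q : G.Params old K} {v w : V} {z : ℝ} (hz : z ≠ 0)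
    (h : z ∈ q.effectRatios v w) : z⁻¹ ∈ q.effectRatios w v := by
  obtain ⟨j, hj, rfl⟩ := mem_effectRatios.1 h
  exact mem_effectRatios.2 ⟨j, fun h0 => hz (by rw [h0, zero_div]), (inv_div _ _).symm⟩

/-- The noise of `v` affects `v` with coefficient one and does not reach `w`. -/
theorem LatentDAG.Params.zero_mem_effectRatios {q : G.Params old K} {v w : V}
    (h : ¬ Relation.ReflTransGen G.obs v w) : (0 : ℝ) ∈ q.effectRatios v w :=
  mem_effectRatios.2 ⟨Sum.inl v, by simp [q.effect_self], by rw [q.effect_eq_zero h, zero_div]⟩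

/-- If `w` is not an ancestor of `v`, then there are at most as many ratios from `v` to `w` as from
`w` to `v`. -/
theorem LatentDAG.Params.card_effectRatios_le_of_not_ancestor {q : G.Params old K} {v w : V}
    (h : ¬ Relation.ReflTransGen G.obs w v) :
    (q.effectRatios v w).card ≤ (q.effectRatios w v).card := by
  -- With the convention `0⁻¹ = 0` inversion stays injective at zero, and its value `0` there is a
  -- ratio from `w` to `v` because of the noise of `w`.
  refine Finset.card_le_card_of_injOn (·⁻¹) (fun z hz => ?_) inv_injective.injOn
  by_cases h0 : z = 0
  · simpa [h0] using zero_mem_effectRatios h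
  · exact inv_mem_effectRatios h0 hz

/-- If `w` is a parent of `s`, then generically there are fewer ratios from `w` to `s` than from
`s` to `w`. -/
theorem LatentDAG.Params.card_effectRatios_lt_of_obs {q : G.Params old K}
    (hq : ∀ w s : V, G.obs w s → ∀ j, q.effect j w ≠ 0 → q.effect j s ≠ 0) {w s : V}
    (h : G.obs w s) : (q.effectRatios w s).card < (q.effectRatios s w).card := by
  classical
  have hne : ∀ z ∈ q.effectRatios w s, z ≠ 0 := by
    intro z hz
    obtain ⟨j, hj, rfl⟩ := mem_effectRatios.1 hz
    exact div_ne_zero (hq w s h j hj) hj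
  have h1 : ((q.effectRatios w s).image (·⁻¹)) ⊂ q.effectRatios s w := by
    refine Finset.ssubset_iff_subset_ne.2 ⟨?_, fun heq => ?_⟩
    · intro z hz
      obtain ⟨y, hy, rfl⟩ := Finset.mem_image.1 hz
      exact inv_mem_effectRatios (hne y hy) hy
    · have h0 := zero_mem_effectRatios (q := q) (G.not_reflTransGen_of_obs h)
      rw [← heq] at h0
      obtain ⟨y, hy, hy0⟩ := Finset.mem_image.1 h0
      exact hne y hy (inv_eq_zero.1 hy0)
  rw [← Finset.card_image_of_injective (q.effectRatios w s) inv_injective]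
  exact Finset.card_lt_card h1

end Generic

end LatentSEM

/-! ### The source criterion -/

theorem mainTheorem5 {V H : Type*} [Fintype V] [Fintype H]
    (G : LatentSEM.LatentDAG V H) (old : H → V) (hold : G.IsOldestChild old)
    (K : ℕ) (hK : ∀ l < Fintype.card V + Fintype.card H, LatentSEM.highOrder l ≤ K) :
    ∀ᵐ q : G.Params old K,
      ∀ (Ω : Type*) [MeasurableSpace Ω] (P : Measure Ω)
        (ε : V → Ω → ℝ) (L : H → Ω → ℝ) (X : V → Ω → ℝ),
        LatentSEM.IsLinearSEM q P ε L X →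
          (∀ v w : V, v ≠ w → (LatentSEM.rankSet P X K v w).Nonempty) ∧
          ∀ s : V, G.IsSource s ↔
            ∀ w : V, w ≠ s →
              sInf (LatentSEM.rankSet P X K s w) ≤ sInf (LatentSEM.rankSet P X K w s) := by
  filter_upwards [LatentSEM.LatentDAG.Params.ae_rank_eq_iff (G := G) (old := old) (K := K),
    LatentSEM.LatentDAG.Params.ae_effect_ne_zero (G := G) (old := old) (K := K)]
    with q hrank heff Ω _ P ε L X hX
  -- The count lies between `1` and `p + m`, so the subtraction is exact and `hK` covers this `l`.
  -- Both infima are then attained minima.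
  have hset : ∀ v w : V, LatentSEM.rankSet P X K v w = {(q.effectRatios v w).card - 1} := by
    intro v w
    have hpos := q.card_effectRatios_pos v w
    have hle := q.card_effectRatios_le v w
    ext l
    simp only [LatentSEM.rankSet, Set.mem_ofPred_eq, Set.mem_singleton_iff]
    constructor
    · rintro ⟨hl, h⟩
      rw [hX.cumMatrix_eq hl, hrank v w l hl] at h
      omega
    · rintro rfl
      have hl := hK ((q.effectRatios v w).card - 1) (by omega)
      refine ⟨hl, ?_⟩
      rw [hX.cumMatrix_eq hl, hrank v w _ hl]
      omega
  refine ⟨fun v w _ => by rw [hset]; exact Set.singleton_nonempty _, fun s => ?_⟩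
  simp only [hset, csInf_singleton]
  constructor
  · intro hs w hw
    exact Nat.sub_le_sub_right
      (LatentSEM.LatentDAG.Params.card_effectRatios_le_of_not_ancestor (hs.not_reflTransGen hw)) 1
  · intro h w hw
    have hws : w ≠ s := by
      rintro rfl
      exact G.acyclic w (Relation.TransGen.single hw)
    have h1 := h w hws
    have h2 := LatentSEM.LatentDAG.Params.card_effectRatios_lt_of_obs heff hw
    have := q.card_effectRatios_pos w s
    omega
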